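/- All spaces are Tychonoff. A group $G$ with a topology is a semitopological group if its multiplication is separately continuous; it is $\omega$-narrow if for every neighborhood $U$ of the neutral element there is a countable set $A\subset G$ with $UA=AU=G$. An action of $G$ on $X$ is separately continuous if all maps $x\mapsto gx$ and all maps $g\mapsto gx$ are continuous. For a space $Y$, $C_p(Y)$ is the set of continuous real-valued functions on $Y$ with the topology of pointwise convergence; a separately continuous action of $G$ on $Y$ is an $s$-action if for every $f\in C_p(Y)$ the subspace $\{y\mapsto f(gy) : g\in G\}$ of $C_p(Y)$ is separable. A space is $k$-separable if it contains a dense $\sigma$-compact set. A continuous map $f:X\to Y$ is skeletal if $\operatorname{Int}\overline{f(U)}\neq\varnothing$ for every nonempty open $U\subset X$. A space $X$ is skeletally Dugundji if there are a nonzero cardinal $\tau$ and an inverse system $S=\{X_\alpha,p^\beta_\alpha,\alpha<\beta<\tau\}$ of spaces, indexed by the ordinals below $\tau$, with surjective skeletal bonding maps $p^\beta_\alpha : X_\beta\to X_\alpha$, such that: (i) $X_0$ is separable metrizable, and whenever $\alpha+1<\tau$ there are a separable metrizable space $M_\alpha$ and an embedding of $X_{\alpha+1}$ in $X_\alpha\times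 M_\alpha$ under which $p^{\alpha+1}_\alpha$ is the restriction of the projection to $X_\alpha$; (ii) for every limit ordinal $\gamma<\tau$ the natural map $X_\gamma\to\varprojlim\{X_\alpha,p^\beta_\alpha,\alpha<\beta<\gamma\}$ is an embedding with dense image; (iii) $X$ embeds in $\varprojlim S$ so that $p_\alpha(X)=X_\alpha$ for every $\alpha<\tau$, where $p_\alpha:\varprojlim S\to X_\alpha$ is the limit projection; (iv) for every bounded continuous $f:\varprojlim S\to\mathbb R$ there are $\alpha<\tau$ and a continuous $g:X_\alpha\to\mathbb R$ with $f=g\circ p_\alpha$. **Theorem 1.4.** Let $X$ admit a separately continuous transitive action $\theta$ of an $\omega$-narrow semitopological group $G$ such that $\theta$ extends to a separately continuous $s$-action of $G$ on a compactification of $X$. If $X$ contains a dense subspace that is Čech-complete and $k$-separable, then $X$ is skeletally Dugundji. -/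

import Mathlib

open Set Topology
open scoped Pointwise BoundedContinuousFunction

universe u v

/-- A semitopological group (Mathlib: `SeparatelyContinuousMul`) is `ω`-narrow if for every
neighborhood `U` of the neutral element there is a countable set `A` with `U A = A U = G`. -/
def IsOmegaNarrow (G : Type*) [Group G] [TopologicalSpace G] : Prop :=
  ∀ U ∈ 𝓝 (1 : G), ∃ A : Set G, A.Countable ∧ U * A = univ ∧ A * U = univ

/-- The action `G × X → X` is separately continuous: all translations `x ↦ g x` and all orbit maps
`g ↦ g x` are continuous. -/
structure IsSeparatelyContinuousAction (G X : Type*) [Group G] [TopologicalSpace G]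
    [TopologicalSpace X] [MulAction G X] : Prop where
  continuous_translation : ∀ g : G, Continuous fun x : X => g • x
  continuous_orbitMap : ∀ x : X, Continuous fun g : G => g • x

/-- `C_p(X)`: the continuous real-valued functions on `X`, with the topology of pointwise
convergence (the subspace topology from the product `X → ℝ`). -/
abbrev Cp (X : Type*) [TopologicalSpace X] : Type _ := {f : X → ℝ // Continuous f}

/-- The orbit `{Θ(g, f) : g ∈ G}` of `f ∈ C_p(X)` under the right action `Θ(g, f)(x) = f (g x)`. -/
def cpOrbit (G : Type*) {X : Type*} [Group G] [TopologicalSpace X] [MulAction G X]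
    (f : Cp X) : Set (Cp X) :=
  {h | ∃ g : G, ∀ x : X, h.1 x = f.1 (g • x)}

/-- An `s`-action: each orbit of `Θ` is a separable subspace of `C_p(X)`. -/
def IsSAction (G X : Type*) [Group G] [TopologicalSpace X] [MulAction G X] : Prop :=
  ∀ f : Cp X, TopologicalSpace.SeparableSpace (cpOrbit G f)

/-- A Tychonoff space is Čech-complete if it is a `G_δ`-subset of its Stone-Čech
compactification. -/
def IsCechComplete (X : Type*) [TopologicalSpace X] : Prop :=
  T35Space X ∧ IsGδ (range (stoneCechUnit : X → StoneCech X))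

/-- A space is `k`-separable if it contains a dense `σ`-compact set. -/
def IsKSeparable (X : Type*) [TopologicalSpace X] : Prop :=
  ∃ Z : Set X, IsSigmaCompact Z ∧ Dense Z

/-- A continuous map is skeletal if the closure of the image of every nonempty open set has
nonempty interior. -/
def IsSkeletalMap {X Y : Type*} [TopologicalSpace X] [TopologicalSpace Y] (f : X → Y) : Prop :=
  Continuous f ∧ ∀ U : Set X, IsOpen U → U.Nonempty → (interior (closure (f '' U))).Nonempty

/-- `f : X → Y` has a metrizable kernel: for some separable metrizable space `M`, the space `X`
is embedded in `Y × M` in such a way that `f` is the restriction of the projection to `Y`. -/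
def HasMetrizableKernel {X Y : Type u} [TopologicalSpace X] [TopologicalSpace Y]
    (f : X → Y) : Prop :=
  ∃ (M : Type u) (_ : TopologicalSpace M), TopologicalSpace.SeparableSpace M ∧
    TopologicalSpace.MetrizableSpace M ∧
    ∃ e : X → Y × M, IsEmbedding e ∧ ∀ x, (e x).1 = f x

/-- Inverse systems of Tychonoff spaces and continuous maps over an ordered set `I`;
`map h : obj j → obj i` is the bonding map for `h : i ≤ j`. -/
structure TopInverseSystem (I : Type v) [Preorder I] where
  obj : I → Type u
  top : ∀ i, TopologicalSpace (obj i)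
  t35 : ∀ i, T35Space (obj i)
  map : ∀ {i j : I}, i ≤ j → obj j → obj i
  continuous_map : ∀ {i j : I} (h : i ≤ j), Continuous (map h)
  map_self : ∀ (i : I) (x : obj i), map (le_refl i) x = x
  map_map : ∀ {i j k : I} (hij : i ≤ j) (hjk : j ≤ k) (x : obj k),
    map hij (map hjk x) = map (hij.trans hjk) x

namespace TopInverseSystem

attribute [instance] TopInverseSystem.top TopInverseSystem.t35

/-- The inverse limit: threads, with the subspace topology from the product. -/
abbrev Limit {I : Type v} [Preorder I] (S : TopInverseSystem.{u, v} I) : Type (max u v) :=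
  {x : ∀ i, S.obj i // ∀ (i j : I) (h : i ≤ j), S.map h (x j) = x i}

/-- The subsystem of all `obj i` with `i < k`. -/
def below {I : Type v} [Preorder I] (S : TopInverseSystem.{u, v} I) (k : I) :
    TopInverseSystem.{u, v} (Iio k) where
  obj i := S.obj i.1
  top i := S.top i.1
  t35 i := S.t35 i.1
  map {i j} h := S.map (i := i.1) (j := j.1) h
  continuous_map {i j} h := S.continuous_map (i := i.1) (j := j.1) h
  map_self i x := S.map_self i.1 x
  map_map {i j k} hij hjk x := S.map_map (i := i.1) (j := j.1) (k := k.1) hij hjk x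

/-- The canonical map from `obj k` to the limit of the subsystem below `k`. -/
def toLimitBelow {I : Type v} [Preorder I] (S : TopInverseSystem.{u, v} I) (k : I)
    (x : S.obj k) : (S.below k).Limit :=
  ⟨fun i => S.map (le_of_lt i.2) x, fun i j h => S.map_map (i := i.1) (j := j.1) h (le_of_lt j.2) x⟩

/-- The system is almost continuous: at a limit index `k`, the space `obj k` is a dense subspace
of the limit of the preceding spaces. -/
def IsAlmostContinuous {I : Type v} [LinearOrder I] (S : TopInverseSystem.{u, v} I) : Prop :=
  ∀ k : I, Order.IsSuccLimit k →
    IsEmbedding (S.toLimitBelow k) ∧ DenseRange (S.toLimitBelow k)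

/-- `X` is the almost limit of the system: it embeds in the limit so that each limit projection
maps `X` onto `obj i`. -/
def IsAlmostLimit {I : Type v} [Preorder I] (S : TopInverseSystem.{u, v} I)
    (X : Type*) [TopologicalSpace X] : Prop :=
  ∃ e : X → S.Limit, IsEmbedding e ∧ ∀ i, Function.Surjective fun x => (e x).1 i

/-- The system is factorizing: every bounded continuous real-valued function on the limit factors
through a limit projection. -/
def IsFactorizing {I : Type v} [Preorder I] (S : TopInverseSystem.{u, v} I) : Prop :=
  ∀ f : S.Limit →ᵇ ℝ, ∃ (i : I) (g : S.obj i → ℝ), Continuous g ∧ ∀ x : S.Limit, f x = g (x.1 i)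

end TopInverseSystem

/-- A skeletally Dugundji space. The index set is the set of ordinals below a nonzero cardinal `τ`;
`IsMin i` says that `i` is the index `0`, and `i ⋖ j` says that `j = i + 1`. -/
def IsSkeletallyDugundji (X : Type u) [TopologicalSpace X] : Prop :=
  ∃ (τ : Cardinal.{u}) (S : TopInverseSystem.{u, u} τ.ord.ToType),
    τ ≠ 0 ∧
    (∀ (i j : τ.ord.ToType) (h : i ≤ j),
      Function.Surjective (S.map h) ∧ IsSkeletalMap (S.map h)) ∧
    (∀ i : τ.ord.ToType, IsMin i →
      TopologicalSpace.SeparableSpace (S.obj i) ∧ TopologicalSpace.MetrizableSpace (S.obj i)) ∧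
    (∀ (i j : τ.ord.ToType) (h : i ⋖ j), HasMetrizableKernel (S.map h.le)) ∧
    S.IsAlmostContinuous ∧
    S.IsAlmostLimit X ∧
    S.IsFactorizing

/-! Embed the compactification `Y` in a power of the line by all its continuous functions. Since the
action is an `s`-action, each function lies in a countable set `S` for which the relation "all
members of `S` agree" is `G`-invariant (`IsSAction.exists_countable`). Hence for any union of such
sets the coordinate projection of `Y` onto a compact `Q` is equivariant. Čech-completeness and
`k`-separability give countably many functions `b n m` that define a dense `G_δ`-set of `Y` inside
the image of `D`. Once these are among the coordinates, this set is a preimage from `Q`, so the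
image of `X` contains a dense `G_δ`-set of `Q`. By `ω`-narrowness countably many translates of a
nonempty open set cover `X`, and Baire's theorem in `Q` makes the projection of `X` skeletal
(`interior_closure_image_nonempty_of_isOmegaNarrow`). Adding the countable sets one at a time along
a well-ordering of the coordinates yields the inverse system (`isSkeletallyDugundji_of_coords`). -/

/-! ### Čech-complete dense subspaces of compact spaces -/

/-- The continuous extension of a dense embedding to the Stone-Čech compactification maps the
remainder to the remainder. -/
theorem mem_range_stoneCechUnit_of_extend_mem {D Y : Type*} [TopologicalSpace D]
    [TopologicalSpace Y] [CompactSpace Y] [T2Space Y] {j : D → Y} (hj : IsEmbedding j)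
    {p : StoneCech D} (hp : stoneCechExtend hj.continuous p ∈ range j) :
    p ∈ range (stoneCechUnit : D → StoneCech D) := by
  obtain ⟨d, hd⟩ := hp
  by_contra hpd
  have hne : p ≠ stoneCechUnit d := fun h => hpd ⟨d, h.symm⟩
  obtain ⟨V, U, hV, hU, hpV, hdU, hVU⟩ := t2_separation hne
  obtain ⟨O, hO, hOU⟩ := hj.isInducing.isOpen_iff.1 (hU.preimage continuous_stoneCechUnit)
  have hdO : j d ∈ O := by
    have : d ∈ j ⁻¹' O := by rw [hOU]; exact hdU
    exact this
  -- Near `p` there are points of `D` mapped into `O`; these lie in `U`, although `V` misses `U`.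
  obtain ⟨x, ⟨hxV, hxO⟩, d', rfl⟩ := denseRange_stoneCechUnit.inter_open_nonempty
    (V ∩ stoneCechExtend hj.continuous ⁻¹' O)
    (hV.inter (hO.preimage (continuous_stoneCechExtend _))) ⟨p, hpV, by simpa [← hd] using hdO⟩
  have hd' : d' ∈ stoneCechUnit ⁻¹' U := by
    rw [← hOU]
    simpa [stoneCechExtend_stoneCechUnit] using hxO
  exact disjoint_left.1 hVU hxV hd'

/-- A Čech-complete space is a `G_δ`-set in each of its compactifications. -/
theorem IsCechComplete.isGδ_range {D Y : Type*} [TopologicalSpace D] [TopologicalSpace Y]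
    [CompactSpace Y] [T2Space Y] {j : D → Y} (hD : IsCechComplete D) (hj : IsEmbedding j)
    (hd : DenseRange j) : IsGδ (range j) := by
  obtain ⟨O, hO, hOD⟩ := isGδ_iff_eq_iInter_nat.1 hD.2
  have hc : Continuous (stoneCechExtend hj.continuous) := continuous_stoneCechExtend _
  have hsurj : Function.Surjective (stoneCechExtend hj.continuous) := by
    rw [← range_eq_univ, ← (isCompact_range hc).isClosed.closure_eq, eq_univ_iff_forall]
    refine fun y => closure_mono ?_ (hd y)
    rintro _ ⟨d, rfl⟩
    exact ⟨stoneCechUnit d, stoneCechExtend_stoneCechUnit _ _⟩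
  -- The remainder goes to the remainder, so the compact images of the sets `(O n)ᶜ` exhaust the
  -- complement of `range j`.
  have key : range j = ⋂ n, (stoneCechExtend hj.continuous '' (O n)ᶜ)ᶜ := by
    ext y
    simp only [mem_iInter, mem_compl_iff, mem_image, not_exists, not_and, not_imp_not]
    constructor
    · rintro hy n p rfl
      by_contra hp
      have := mem_range_stoneCechUnit_of_extend_mem hj hy
      rw [hOD] at this
      exact hp (mem_iInter.1 this n)
    · intro h
      obtain ⟨p, rfl⟩ := hsurj y
      have hp : p ∈ range (stoneCechUnit : D → StoneCech D) := by
        rw [hOD]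
        exact mem_iInter.2 fun n => h n p rfl
      obtain ⟨d, rfl⟩ := hp
      exact ⟨d, (stoneCechExtend_stoneCechUnit _ _).symm⟩
  rw [key]
  exact .iInter_of_isOpen fun n =>
    ((hO n).isClosed_compl.isCompact.image hc).isClosed.isOpen_compl

/-- A dense Čech-complete `k`-separable subspace of a compact space contains a dense set that is a
countable intersection of countable unions of cozero-sets. -/
theorem exists_continuous_pos_of_isCechComplete_of_isKSeparable {D Y : Type*} [TopologicalSpace D]
    [TopologicalSpace Y] [CompactSpace Y] [T2Space Y] {j : D → Y} (hj : IsEmbedding j)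
    (hd : DenseRange j) (hD : IsCechComplete D) (hk : IsKSeparable D) :
    ∃ b : ℕ → ℕ → C(Y, ℝ), (⋂ n, ⋃ m, {y | 0 < b n m y}) ⊆ range j ∧
      Dense (⋂ n, ⋃ m, {y | 0 < b n m y}) := by
  obtain ⟨O, hO, hOD⟩ := isGδ_iff_eq_iInter_nat.1 (hD.isGδ_range hj hd)
  obtain ⟨Z, ⟨K, hK, hKZ⟩, hZ⟩ := hk
  have hKO (n m) : j '' K m ⊆ O n := by
    rintro _ ⟨d, -, rfl⟩
    have : j d ∈ ⋂ n, O n := hOD ▸ mem_range_self d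
    exact mem_iInter.1 this n
  -- Urysohn: the cozero-set of `b n m` lies between the compact set `j '' K m` and `O n`.
  have hb (n m) : ∃ b : C(Y, ℝ), EqOn b 0 (O n)ᶜ ∧ EqOn b 1 (j '' K m) ∧
      ∀ y, b y ∈ Icc (0 : ℝ) 1 :=
    exists_continuous_zero_one_of_isClosed (hO n).isClosed_compl
      ((hK m).image hj.continuous).isClosed (disjoint_compl_left_iff_subset.2 (hKO n m))
  choose b hb0 hb1 _ using hb
  refine ⟨b, ?_, ?_⟩
  · intro y hy
    rw [hOD]
    refine mem_iInter.2 fun n => ?_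
    obtain ⟨m, hm⟩ := mem_iUnion.1 (mem_iInter.1 hy n)
    by_contra hn
    have : b n m y = 0 := hb0 n m hn
    exact absurd hm (by simp [this])
  · refine (hd.dense_image hj.continuous hZ).mono ?_
    rintro _ ⟨z, hz, rfl⟩
    rw [← hKZ] at hz
    obtain ⟨m, hm⟩ := mem_iUnion.1 hz
    refine mem_iInter.2 fun n => mem_iUnion.2 ⟨m, ?_⟩
    have : b n m (j z) = 1 := hb1 n m (mem_image_of_mem _ hm)
    simp [this]

/-! ### Skeletal maps from `ω`-narrow groups and `s`-actions -/

/-- Under a transitive action of an `ω`-narrow group, countably many translates of a nonempty open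
set cover the space. -/
theorem IsOmegaNarrow.exists_countable_iUnion_smul_eq_univ {G X : Type*} [Group G]
    [TopologicalSpace G] [SeparatelyContinuousMul G] (hG : IsOmegaNarrow G) [TopologicalSpace X]
    [MulAction G X] (hX : IsSeparatelyContinuousAction G X) [MulAction.IsPretransitive G X]
    {U : Set X} (hU : IsOpen U) (hne : U.Nonempty) :
    ∃ A : Set G, A.Countable ∧ ∀ x : X, ∃ a ∈ A, ∃ u ∈ U, a • u = x := by
  obtain ⟨x₀, hx₀⟩ := hne
  obtain ⟨A, hA, -, hAU⟩ := hG ((fun g : G => g • x₀) ⁻¹' U)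
    ((hU.preimage (hX.continuous_orbitMap x₀)).mem_nhds (by simpa using hx₀))
  refine ⟨A, hA, fun x => ?_⟩
  obtain ⟨g, rfl⟩ := MulAction.exists_smul_eq G x₀ x
  obtain ⟨a, ha, v, hv, rfl⟩ : g ∈ A * _ := hAU ▸ mem_univ g
  exact ⟨a, ha, v • x₀, hv, (mul_smul _ _ _).symm⟩

/-- Under a transitive action of an `ω`-narrow group, an equivariant quotient `k` of a
compactification such that `k` maps `X` onto a set containing a dense `G_δ`-set is skeletal
on `X`. -/
theorem interior_closure_image_nonempty_of_isOmegaNarrow {G X Y Q : Type*} [Group G]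
    [TopologicalSpace G] [SeparatelyContinuousMul G] (hG : IsOmegaNarrow G) [TopologicalSpace X]
    [MulAction G X] (hX : IsSeparatelyContinuousAction G X) [MulAction.IsPretransitive G X]
    [TopologicalSpace Y] [CompactSpace Y] [MulAction G Y]
    (hY : ∀ g : G, Continuous fun y : Y => g • y)
    {ι : X → Y} (hext : ∀ (g : G) (x : X), ι (g • x) = g • ι x)
    [TopologicalSpace Q] [CompactSpace Q] [T2Space Q] {k : Y → Q} (hk : Continuous k)
    (hks : Function.Surjective k)
    (hinv : ∀ y y', k y = k y' → ∀ g : G, k (g • y) = k (g • y'))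
    {P : Set Q} (hP : IsGδ P) (hPd : Dense P) (hPX : P ⊆ range (k ∘ ι))
    {U : Set X} (hU : IsOpen U) (hne : U.Nonempty) :
    (interior (closure ((k ∘ ι) '' U))).Nonempty := by
  -- By `hinv` the translations of `Y` descend along the quotient map `k`.
  have hT (g : G) : ∃ T : Q → Q, Continuous T ∧ ∀ y, T (k y) = k (g • y) := by
    refine ⟨fun q => k (g • Function.surjInv hks q), ?_, fun y => hinv _ _ ?_ g⟩
    · rw [(hk.isClosedMap.isQuotientMap hk hks).continuous_iff]
      refine (hk.comp (hY g)).congr fun y => hinv _ _ ?_ g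
      exact (Function.surjInv_eq hks _).symm
    · exact Function.surjInv_eq hks _
  choose T hTc hTk using hT
  have hTT (g : G) (q : Q) : T g⁻¹ (T g q) = q := by
    obtain ⟨y, rfl⟩ := hks q
    simp [hTk]
  obtain ⟨A, hA, hAU⟩ := hG.exists_countable_iUnion_smul_eq_univ hX hU hne
  have : Countable A := hA.to_subtype
  -- Baire: countably many closed translates cover the dense `G_δ`-set `P`, so one has interior; `T
  -- a.1⁻¹` carries it back.
  have hdense := hP.dense_iUnion_interior_of_closed hPd
    (f := fun a : A => closure (T a.1 '' ((k ∘ ι) '' U))) (fun _ => isClosed_closure) (by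
      intro q hq
      obtain ⟨x, rfl⟩ := hPX hq
      obtain ⟨a, ha, u, hu, rfl⟩ := hAU x
      refine mem_iUnion.2 ⟨⟨a, ha⟩, subset_closure ⟨_, mem_image_of_mem _ hu, ?_⟩⟩
      simp [hTk, hext])
  have : Nonempty Q := hne.to_type.map (k ∘ ι)
  obtain ⟨q, hq⟩ := hdense.nonempty
  obtain ⟨a, ha⟩ := mem_iUnion.1 hq
  refine ⟨T a.1⁻¹ q, mem_interior.2 ⟨T a.1 ⁻¹' interior (closure (T a.1 '' ((k ∘ ι) '' U))), ?_,
    isOpen_interior.preimage (hTc a.1), ?_⟩⟩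
  · intro r hr
    have h1 := image_closure_subset_closure_image (hTc a.1⁻¹)
      (mem_image_of_mem (T a.1⁻¹) (interior_subset hr))
    rw [image_image] at h1
    simpa [hTT] using h1
  · have : T a.1 (T a.1⁻¹ q) = q := by simpa using hTT a.1⁻¹ q
    simpa [this] using ha

/-- Nonemptiness of the interior of the closure passes to dense subspaces. -/
theorem Topology.IsInducing.interior_closure_nonempty {R Q : Type*} [TopologicalSpace R]
    [TopologicalSpace Q] {j : R → Q} (hj : IsInducing j) (hd : DenseRange j) {S : Set R}
    (hS : (interior (closure (j '' S))).Nonempty) : (interior (closure S)).Nonempty := by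
  obtain ⟨_, hr, r, rfl⟩ := hd.inter_open_nonempty _ isOpen_interior hS
  refine ⟨r, interior_maximal ?_ (isOpen_interior.preimage hj.continuous) hr⟩
  rw [hj.closure_eq_preimage_closure_image]
  exact preimage_mono interior_subset

/-- A continuous function on a compact space with an `s`-action lies in a countable subset of its
orbit that determines an invariant equivalence relation. -/
theorem IsSAction.exists_countable {G Y : Type*} [Group G] [TopologicalSpace G]
    [TopologicalSpace Y] [MulAction G Y] (hY : ∀ g : G, Continuous fun y : Y => g • y)
    (hs : IsSAction G Y) (f : C(Y, ℝ)) :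
    ∃ S : Set C(Y, ℝ), S.Countable ∧ f ∈ S ∧ ∀ y y', (∀ u ∈ S, u y = u y') →
      ∀ u ∈ S, ∀ g : G, u (g • y) = u (g • y') := by
  have := hs ⟨f, f.continuous⟩
  obtain ⟨s, hs, hsd⟩ :=
    TopologicalSpace.exists_countable_dense (cpOrbit G (⟨f, f.continuous⟩ : Cp Y))
  let c : cpOrbit G (⟨f, f.continuous⟩ : Cp Y) → C(Y, ℝ) := fun w => ⟨w.1.1, w.1.2⟩
  refine ⟨insert f (c '' s), (hs.image c).insert f, mem_insert _ _, fun y y' h => ?_⟩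
  -- Agreement at `y` and `y'` is a closed condition in `C_p(Y)`, so it spreads from a dense set to
  -- the whole orbit.
  have hw (w : cpOrbit G (⟨f, f.continuous⟩ : Cp Y)) : w.1.1 y = w.1.1 y' := by
    have hcl : IsClosed {w : cpOrbit G (⟨f, f.continuous⟩ : Cp Y) | w.1.1 y = w.1.1 y'} :=
      isClosed_eq
        ((continuous_apply y).comp (continuous_subtype_val.comp continuous_subtype_val))
        ((continuous_apply y').comp (continuous_subtype_val.comp continuous_subtype_val))
    exact hcl.closure_subset_iff.2
      (fun w hw => h (c w) (mem_insert_of_mem _ (mem_image_of_mem _ hw))) (hsd w)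
  have hf (g : G) : f (g • y) = f (g • y') :=
    hw ⟨⟨fun z => f (g • z), f.continuous.comp (hY g)⟩, g, fun _ => rfl⟩
  rintro u (rfl | ⟨⟨w, a, ha⟩, -, rfl⟩) g
  · exact hf g
  · change w.1 (g • y) = w.1 (g • y')
    rw [ha, ha]
    simpa [mul_smul] using hf (a * g)

/-! ### Inverse systems of coordinate projections -/

/-- The map `x ↦ (ev x h)ₕ` with all coordinates outside `F` replaced by zero. -/
noncomputable def restrictCoords {X E : Type*} (ev : X → E → ℝ) (F : Set E) (x : X) : E → ℝ :=
  F.indicator (ev x)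

theorem continuous_indicator_coords {E : Type*} (F : Set E) :
    Continuous fun v : E → ℝ => F.indicator v := by
  classical
  refine continuous_pi fun h => ?_
  by_cases hh : h ∈ F
  · simpa [hh] using continuous_apply h
  · simpa [hh] using continuous_const

theorem indicator_restrictCoords {X E : Type*} (ev : X → E → ℝ) {F F' : Set E} (h : F ⊆ F')
    (x : X) : F.indicator (restrictCoords ev F' x) = restrictCoords ev F x := by
  rw [restrictCoords, indicator_indicator, inter_eq_left.2 h, restrictCoords]

/-- The inverse system of the images of `X` under increasing families of coordinates. -/
noncomputable def coordSystem {X E I : Type u} [Preorder I] (ev : X → E → ℝ) (F : I → Set E)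
    (hF : Monotone F) : TopInverseSystem.{u, u} I where
  obj i := range (restrictCoords ev (F i))
  top i := inferInstance
  t35 i := inferInstance
  map {i j} h v := ⟨(F i).indicator v.1, by
    obtain ⟨_, x, rfl⟩ := v
    exact ⟨x, (indicator_restrictCoords ev (hF h) x).symm⟩⟩
  continuous_map h :=
    ((continuous_indicator_coords _).comp continuous_subtype_val).subtype_mk _
  map_self i := by
    rintro ⟨_, x, rfl⟩
    exact Subtype.ext (indicator_restrictCoords ev subset_rfl x)
  map_map {i j k} hij hjk v := Subtype.ext (by
    simp only [indicator_indicator, inter_eq_left.2 (hF hij)])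

section coordSystem

variable {X E I : Type u} {ev : X → E → ℝ}

theorem isEmbedding_coordSystem_val [Preorder I] {F : I → Set E} (hF : Monotone F) (i : I) :
    IsEmbedding fun v : (coordSystem ev F hF).obj i => v.1 :=
  IsEmbedding.subtypeVal (p := (· ∈ range (restrictCoords ev (F i))))

/-- The projection of `X` onto a space of the system `coordSystem`. -/
noncomputable def coordProj [Preorder I] (ev : X → E → ℝ) (F : I → Set E) (hF : Monotone F)
    (i : I) (x : X) : (coordSystem ev F hF).obj i :=
  ⟨restrictCoords ev (F i) x, x, rfl⟩

theorem coordProj_surjective [Preorder I] {F : I → Set E} (hF : Monotone F) (i : I) :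
    Function.Surjective (coordProj ev F hF i) := by
  rintro ⟨_, x, rfl⟩
  exact ⟨x, rfl⟩

theorem map_coordProj [Preorder I] {F : I → Set E} (hF : Monotone F) {i j : I} (h : i ≤ j)
    (x : X) : (coordSystem ev F hF).map h (coordProj ev F hF j x) = coordProj ev F hF i x :=
  Subtype.ext (indicator_restrictCoords ev (hF h) x)

theorem continuous_coordProj [Preorder I] [TopologicalSpace X] (hev : Continuous ev)
    {F : I → Set E} (hF : Monotone F) (i : I) : Continuous (coordProj ev F hF i) :=
  ((continuous_indicator_coords (F i)).comp hev).subtype_mk _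

theorem coordSystem_map_surjective [Preorder I] {F : I → Set E} (hF : Monotone F) {i j : I}
    (h : i ≤ j) : Function.Surjective ((coordSystem ev F hF).map h) := fun v => by
  obtain ⟨x, rfl⟩ := coordProj_surjective hF i v
  exact ⟨_, map_coordProj hF h x⟩

/-- An open set upstairs has the same image as its preimage in `X`, so only the projections of `X`
matter. -/
theorem coordSystem_map_isSkeletalMap [Preorder I] [TopologicalSpace X] (hev : Continuous ev)
    {F : I → Set E} (hF : Monotone F) {i j : I} (h : i ≤ j)
    (hsk : IsSkeletalMap (coordProj ev F hF i)) :
    IsSkeletalMap ((coordSystem ev F hF).map h) := by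
  refine ⟨(coordSystem ev F hF).continuous_map h, fun U hU hne => ?_⟩
  convert hsk.2 (coordProj ev F hF j ⁻¹' U) (hU.preimage (continuous_coordProj hev hF j))
    (hne.preimage (coordProj_surjective hF j)) using 3
  conv_lhs => rw [← image_preimage_eq U (coordProj_surjective hF j), image_image]
  simp only [map_coordProj]

theorem coordSystem_separable_metrizable [Preorder I] {F : I → Set E} (hF : Monotone F) {i : I}
    (hi : (F i).Countable) : TopologicalSpace.SeparableSpace ((coordSystem ev F hF).obj i) ∧
      TopologicalSpace.MetrizableSpace ((coordSystem ev F hF).obj i) := by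
  classical
  have : Countable (F i) := hi.to_subtype
  have hemb : IsEmbedding fun (v : (coordSystem ev F hF).obj i) (h : F i) => v.1 h.1 := by
    let r : (F i → ℝ) → E → ℝ := fun w h => if hh : h ∈ F i then w ⟨h, hh⟩ else 0
    have hr : Continuous r := by
      refine continuous_pi fun h => ?_
      by_cases hh : h ∈ F i
      · simpa [r, hh] using continuous_apply (⟨h, hh⟩ : F i)
      · simpa [r, hh] using continuous_const
    refine .of_comp
      (continuous_pi fun h => (continuous_apply h.1).comp continuous_subtype_val) hr ?_
    convert isEmbedding_coordSystem_val (ev := ev) hF i using 1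
    funext v
    obtain ⟨_, x, rfl⟩ := v
    funext h
    change (if h ∈ F i then (F i).indicator (ev x) h else 0) = (F i).indicator (ev x) h
    by_cases hh : h ∈ F i <;> simp [hh]
  have := hemb.secondCountableTopology
  exact ⟨inferInstance, hemb.metrizableSpace⟩

theorem coordSystem_hasMetrizableKernel [Preorder I] {F : I → Set E} (hF : Monotone F) {i j : I}
    (h : i ≤ j) (hd : (F j \ F i).Countable) :
    HasMetrizableKernel ((coordSystem ev F hF).map h) := by
  classical
  have : Countable (F j \ F i : Set E) := hd.to_subtype
  refine ⟨(F j \ F i : Set E) → ℝ, inferInstance, inferInstance, inferInstance,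
    fun v => ((coordSystem ev F hF).map h v, fun e => v.1 e.1), ?_, fun _ => rfl⟩
  -- Reconstructs the point: new coordinates come from the metrizable factor, all others from the
  -- projection.
  let r : (coordSystem ev F hF).obj i × ((F j \ F i : Set E) → ℝ) → E → ℝ :=
    fun w e => if he : e ∈ F j \ F i then w.2 ⟨e, he⟩ else w.1.1 e
  have hr : Continuous r := by
    refine continuous_pi fun e => ?_
    by_cases he : e ∈ F j \ F i
    · simp only [r, he, dite_true]
      exact (continuous_apply _).comp continuous_snd
    · simp only [r, he, dite_false]
      exact (continuous_apply e).comp (continuous_subtype_val.comp continuous_fst)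
  refine .of_comp (((coordSystem ev F hF).continuous_map h).prodMk
    (continuous_pi fun e => (continuous_apply e.1).comp continuous_subtype_val)) hr ?_
  convert isEmbedding_coordSystem_val (ev := ev) hF j using 1
  funext v
  obtain ⟨_, x, rfl⟩ := v
  funext e
  by_cases hi : e ∈ F i
  · simp [r, hi, coordSystem]
  · by_cases hj : e ∈ F j <;> simp [r, hi, hj, coordSystem, restrictCoords]

theorem coordSystem_isAlmostContinuous [LinearOrder I] {F : I → Set E} (hF : Monotone F)
    (hlim : ∀ k, Order.IsSuccLimit k → F k ⊆ ⋃ i < k, F i) :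
    (coordSystem ev F hF).IsAlmostContinuous := by
  classical
  intro k hk
  have hcont : Continuous ((coordSystem ev F hF).toLimitBelow k) :=
    (continuous_pi fun i : Iio k => (coordSystem ev F hF).continuous_map i.2.le).subtype_mk _
  constructor
  · have hex (e : F k) : ∃ i : Iio k, e.1 ∈ F i := by
      simpa using hlim k hk e.2
    choose c hc using hex
    -- Each coordinate in `F k` is read off at an earlier stage `c` that already contains it.
    let r : ((coordSystem ev F hF).below k).Limit → E → ℝ :=
      fun w e => if he : e ∈ F k then (w.1 (c ⟨e, he⟩)).1 e else 0
    have hr : Continuous r := by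
      refine continuous_pi fun e => ?_
      by_cases he : e ∈ F k
      · simp only [r, he, dite_true]
        exact (continuous_apply e).comp (continuous_subtype_val.comp
          ((continuous_apply (c ⟨e, he⟩)).comp continuous_subtype_val))
      · simpa only [r, he, dite_false] using continuous_const
    refine .of_comp hcont hr ?_
    convert isEmbedding_coordSystem_val (ev := ev) hF k using 1
    funext v
    obtain ⟨_, x, rfl⟩ := v
    funext e
    change (if he : e ∈ F k then (F (c ⟨e, he⟩)).indicator ((F k).indicator (ev x)) e else 0) =
      (F k).indicator (ev x) e
    by_cases he : e ∈ F k
    · rw [dif_pos he]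
      exact indicator_of_mem (hc ⟨e, he⟩) _
    · simp [he]
  · intro w
    obtain ⟨i₀, hi₀⟩ : ∃ i, i < k := not_isMin_iff.1 hk.1
    have : Nonempty (Iio k) := ⟨⟨i₀, hi₀⟩⟩
    -- Points of `X` matching the thread at stage `i` match it at all earlier stages, so their
    -- images converge to `w`.
    have hx (i : Iio k) : ∃ x, coordProj ev F hF i.1 x = w.1 i := coordProj_surjective hF i.1 _
    choose x hx using hx
    refine mem_closure_of_tendsto (b := Filter.atTop)
      (f := fun i => (coordSystem ev F hF).toLimitBelow k (coordProj ev F hF k (x i))) ?_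
      (.of_forall fun i => mem_range_self _)
    rw [tendsto_subtype_rng, tendsto_pi_nhds]
    intro i
    refine tendsto_const_nhds.congr' ?_
    filter_upwards [Filter.eventually_ge_atTop i] with j hj
    rw [← w.2 i j hj, ← hx j]
    exact (map_coordProj hF (show i.1 ≤ j.1 from hj) _).trans (map_coordProj hF i.2.le _).symm

theorem coordSystem_isAlmostLimit [LinearOrder I] [TopologicalSpace X] (hev : IsEmbedding ev)
    {F : I → Set E} (hF : Monotone F) {δ : I} (hδ : F δ = univ) :
    (coordSystem ev F hF).IsAlmostLimit X := by
  refine ⟨fun x => ⟨fun i => coordProj ev F hF i x, fun i j h => map_coordProj hF h x⟩,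
    ?_, fun i => coordProj_surjective hF i⟩
  refine .of_comp (g := fun w => (w.1 δ).1)
    ((continuous_pi fun i => continuous_coordProj hev.continuous hF i).subtype_mk _)
    (continuous_subtype_val.comp ((continuous_apply δ).comp continuous_subtype_val)) ?_
  convert hev using 1
  funext x
  simp [coordProj, restrictCoords, hδ]

/-- A thread is determined by its entry at `δ`, and `s` rebuilds it continuously. -/
theorem coordSystem_isFactorizing [LinearOrder I] {F : I → Set E} (hF : Monotone F) {δ : I}
    (hδ : F δ = univ) : (coordSystem ev F hF).IsFactorizing := by
  intro f
  have hmem (i : I) (v : (coordSystem ev F hF).obj δ) :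
      (F i).indicator v.1 ∈ range (restrictCoords ev (F i)) := by
    obtain ⟨_, x, rfl⟩ := v
    exact ⟨x, (indicator_restrictCoords ev (by simp [hδ]) x).symm⟩
  let s : (coordSystem ev F hF).obj δ → (coordSystem ev F hF).Limit := fun v =>
    ⟨fun i => ⟨(F i).indicator v.1, hmem i v⟩, fun i j h => Subtype.ext (by
      change (F i).indicator ((F j).indicator v.1) = _
      rw [indicator_indicator, inter_eq_left.2 (hF h)])⟩
  have hs : Continuous s := Continuous.subtype_mk (continuous_pi fun i =>
    ((continuous_indicator_coords (F i)).comp continuous_subtype_val).subtype_mk _) _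
  refine ⟨δ, fun v => f (s v), f.continuous.comp hs, fun w => ?_⟩
  congr 1
  refine Subtype.ext (funext fun i => ?_)
  rcases le_total i δ with h | h
  · exact (w.2 i δ h).symm
  · have hi : F i = univ := univ_subset_iff.1 (hδ ▸ hF h)
    refine Subtype.ext ?_
    change _ = (F i).indicator (w.1 δ).1
    rw [← w.2 δ i h]
    change _ = (F i).indicator ((F δ).indicator (w.1 i).1)
    simp [hi, hδ]

end coordSystem

/-! ### From coordinates to skeletally Dugundji spaces -/

/-- A space embedded in a power of the line is skeletally Dugundji if the coordinates are grouped
into countable sets `N h` such that the projections to all sufficiently large unions of these sets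
are skeletal. The system has the length of the successor of the number of coordinates and exhausts
them before its end, so that it is factorizing also when that number has countable cofinality. -/
theorem isSkeletallyDugundji_of_coords {X E : Type u} [TopologicalSpace X] {ev : X → E → ℝ}
    (hev : IsEmbedding ev) {N : E → Set E} (hN : ∀ h, h ∈ N h) (hNc : ∀ h, (N h).Countable)
    {B : Set E} (hB : B.Countable)
    (hsk : ∀ J : Set E, B ⊆ J →
      IsSkeletalMap (rangeFactorization (restrictCoords ev (⋃ h ∈ J, N h)))) :
    IsSkeletallyDugundji X := by
  let τ : Cardinal.{u} := Order.succ (Cardinal.mk E)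
  obtain ⟨e⟩ : Nonempty (PrincipalSeg (WellOrderingRel : E → E → Prop)
      ((· < ·) : τ.ord.ToType → τ.ord.ToType → Prop)) := by
    rw [← Ordinal.type_lt_iff, Ordinal.type_toType, Cardinal.lt_ord, Ordinal.card_type]
    exact Order.lt_succ _
  let J : τ.ord.ToType → Set E := fun i => B ∪ {h | e h < i}
  let F : τ.ord.ToType → Set E := fun i => ⋃ h ∈ J i, N h
  have hJ : Monotone J := fun i j hij =>
    union_subset_union_right _ fun h (hh : e h < i) => hh.trans_le hij
  have hF : Monotone F := fun i j hij => biUnion_subset_biUnion_left (hJ hij)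
  have hδ : F e.top = univ := eq_univ_of_forall fun h =>
    mem_biUnion (show h ∈ J e.top from Or.inr (e.lt_top h)) (hN h)
  refine ⟨τ, coordSystem ev F hF, ?_, fun i j h => ⟨coordSystem_map_surjective hF h,
    coordSystem_map_isSkeletalMap hev.continuous hF h (hsk (J i) subset_union_left)⟩,
    fun i hi => coordSystem_separable_metrizable hF ?_,
    fun i j hij => coordSystem_hasMetrizableKernel hF hij.le ?_,
    coordSystem_isAlmostContinuous hF fun k hk => ?_,
    coordSystem_isAlmostLimit hev hF hδ, coordSystem_isFactorizing hF hδ⟩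
  · exact (bot_lt_of_lt (Order.lt_succ (Cardinal.mk E))).ne'
  · refine Countable.biUnion (hB.mono ?_) fun h _ => hNc h
    exact union_subset subset_rfl fun h (hh : e h < i) => absurd hh hi.not_lt
  -- Passing to the next index adds at most the one `h` with `e h = i`.
  · have hc : {h | e h = i}.Countable :=
      Set.Subsingleton.countable fun h hh h' hh' => e.injective (hh.trans hh'.symm)
    refine (hc.biUnion fun h _ => hNc h).mono ?_
    rintro u ⟨huj, hui⟩
    obtain ⟨h, hh, hu⟩ := mem_iUnion₂.1 huj
    refine mem_biUnion (x := h) ?_ hu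
    have hhi : h ∉ J i := fun hh => hui (mem_biUnion hh hu)
    rcases hh with hh | hh
    · exact absurd (Or.inl hh) hhi
    · exact (le_of_not_gt fun hlt => hij.2 hlt hh).eq_of_not_lt fun hlt => hhi (Or.inr hlt)
  · intro u hu
    obtain ⟨i₀, hi₀⟩ : ∃ i, i < k := not_isMin_iff.1 hk.1
    obtain ⟨h, hh | hh, hu⟩ := mem_iUnion₂.1 hu
    · exact mem_biUnion (show i₀ ∈ Iio k from hi₀) (mem_biUnion (show h ∈ J i₀ from Or.inl hh) hu)
    · obtain ⟨i, hi, hik⟩ := hk.lt_iff_exists_lt.1 hh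
      exact mem_biUnion (show i ∈ Iio k from hi) (mem_biUnion (show h ∈ J i from Or.inr hik) hu)

/-! ### The main theorem -/

theorem theorem1p4 {G : Type*} [Group G] [TopologicalSpace G] [SeparatelyContinuousMul G]
    (hG : IsOmegaNarrow G)
    {X : Type u} [TopologicalSpace X] [T35Space X] [MulAction G X]
    (hX : IsSeparatelyContinuousAction G X) (htrans : MulAction.IsPretransitive G X)
    {Y : Type v} [TopologicalSpace Y] [CompactSpace Y] [T2Space Y] [MulAction G Y]
    (hY : IsSeparatelyContinuousAction G Y) (hs : IsSAction G Y)
    (ι : X → Y) (hι : IsDenseEmbedding ι) (hext : ∀ (g : G) (x : X), ι (g • x) = g • ι x)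
    (D : Set X) (hD : Dense D) (hDc : IsCechComplete D) (hDk : IsKSeparable D) :
    IsSkeletallyDugundji X := by
  obtain ⟨b, hbD, hbd⟩ := exists_continuous_pos_of_isCechComplete_of_isKSeparable (D := D)
    (j := ι ∘ Subtype.val)
    (hι.isEmbedding.comp IsEmbedding.subtypeVal)
    (hι.dense.comp hD.denseRange_val hι.continuous) hDc hDk
  choose S hSc hSf hSinv using hs.exists_countable hY.continuous_translation
  -- Restricting to the dense `X` loses nothing and keeps the index set in the universe of `X`.
  let E : Type u := range fun f : C(Y, ℝ) => f.comp ⟨ι, hι.continuous⟩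
  let res : C(Y, ℝ) → E := rangeFactorization _
  have hE (h : E) : ∃ f, res f = h := rangeFactorization_surjective h
  choose ext hres using hE
  have hextres (f : C(Y, ℝ)) : ext (res f) = f := by
    have h : (ext (res f)).comp ⟨ι, hι.continuous⟩ = f.comp ⟨ι, hι.continuous⟩ :=
      congrArg Subtype.val (hres (res f))
    refine ContinuousMap.ext fun y => congrFun (hι.dense.equalizer (map_continuous _)
      (map_continuous _) (funext fun x => ?_)) y
    exact DFunLike.congr_fun h x
  let evY : Y → E → ℝ := fun y h => ext h y
  have hevYc : Continuous evY := continuous_pi fun h => (ext h).continuous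
  have hevY : IsEmbedding evY := by
    refine (hevYc.isClosedEmbedding fun y y' hyy' => ?_).isEmbedding
    by_contra hne
    obtain ⟨f, hf0, hf1, -⟩ := exists_continuous_zero_one_of_isClosed
      (isClosed_singleton (x := y)) (isClosed_singleton (x := y')) (by simpa using hne)
    have h : ext (res f) y = ext (res f) y' := congrFun hyy' (res f)
    rw [hextres, hf0 rfl, hf1 rfl] at h
    simp at h
  refine isSkeletallyDugundji_of_coords (hevY.comp hι.isEmbedding) (N := fun h => res '' S (ext h))
    (fun h => ⟨ext h, hSf _, hres h⟩) (fun h => (hSc _).image _)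
    (B := range fun p : ℕ × ℕ => res (b p.1 p.2)) (countable_range _) fun J hJ => ?_
  let F : Set E := ⋃ h ∈ J, res '' S (ext h)
  have hbF (n m : ℕ) : res (b n m) ∈ F :=
    mem_biUnion (hJ ⟨(n, m), rfl⟩) ⟨b n m, by simpa [hextres] using hSf (b n m), rfl⟩
  have hkc : Continuous (restrictCoords evY F) := (continuous_indicator_coords F).comp hevYc
  have : CompactSpace (range (restrictCoords evY F)) :=
    isCompact_iff_compactSpace.1 (isCompact_range hkc)
  let k : Y → range (restrictCoords evY F) := rangeFactorization (restrictCoords evY F)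
  have hk : Continuous k := hkc.subtype_mk _
  have hks : Function.Surjective k := rangeFactorization_surjective
  have hkF {y : Y} {h : E} (hh : h ∈ F) : (k y).1 h = ext h y :=
    indicator_of_mem hh (evY y)
  have hinv (y y' : Y) (hyy' : k y = k y') (g : G) : k (g • y) = k (g • y') := by
    refine Subtype.ext (indicator_congr fun u hu => ?_)
    obtain ⟨h, hh, w, hw, rfl⟩ := mem_iUnion₂.1 hu
    rw [hextres]
    refine hSinv (ext h) y y' (fun v hv => ?_) w hw g
    have hvF : res v ∈ F := mem_biUnion hh (mem_image_of_mem _ hv)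
    rw [← hextres v, ← hkF hvF, ← hkF hvF, hyy']
  -- All `b n m` are coordinates in `F`, so the dense `G_δ`-set is saturated under `k`.
  have hpre (y : Y) : (k y ∈ ⋂ n, ⋃ m, {q : range (restrictCoords evY F) |
      0 < q.1 (res (b n m))}) ↔ y ∈ ⋂ n, ⋃ m, {y | 0 < b n m y} := by
    simp only [mem_iInter, mem_iUnion, mem_ofPred_eq, hkF (hbF _ _), hextres]
  refine ⟨((continuous_indicator_coords F).comp
    (hevYc.comp hι.continuous)).subtype_mk _, fun U hU hne => ?_⟩
  -- The image of `X` need not be compact; the Baire argument runs in the image of `Y`, where it is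
  -- dense.
  let j : range (restrictCoords (evY ∘ ι) F) → range (restrictCoords evY F) :=
    inclusion (by rintro _ ⟨x, rfl⟩; exact ⟨ι x, rfl⟩)
  have hjι (x : X) : j (rangeFactorization (restrictCoords (evY ∘ ι) F) x) = k (ι x) := rfl
  refine (IsEmbedding.inclusion _).isInducing.interior_closure_nonempty (j := j) ?_ ?_
  · refine (hks.denseRange.comp hι.dense hk).mono ?_
    rintro _ ⟨x, rfl⟩
    exact ⟨_, hjι x⟩
  · rw [image_image]
    refine interior_closure_image_nonempty_of_isOmegaNarrow hG hX hY.continuous_translation hext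
      hk hks hinv (P := ⋂ n, ⋃ m, {q | 0 < q.1 (res (b n m))}) ?_ ?_ ?_ hU hne
    · exact .iInter_of_isOpen fun n => isOpen_iUnion fun m => isOpen_lt continuous_const
        ((continuous_apply _).comp continuous_subtype_val)
    · refine (hks.denseRange.dense_image hk hbd).mono ?_
      rintro _ ⟨y, hy, rfl⟩
      exact (hpre y).2 hy
    · intro q hq
      obtain ⟨y, rfl⟩ := hks q
      obtain ⟨d, rfl⟩ := hbD ((hpre y).1 hq)
      exact ⟨d.1, rfl⟩
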